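/- Let $R=\Bbbk[x_0,\dots,x_n]$ be a polynomial ring over a field and let $I\subseteq R$ be a monomial ideal. Let $\operatorname{Ass}(I)$ be the set of associated primes of $R/I$, let $\operatorname{maxAss}(I)$ be the set of its inclusion-maximal elements, and let $e$ be the big-height of $I$, i.e. the maximum of the heights of the primes in $\operatorname{Ass}(I)$ (with $e=0$ if $I=R$). For an ideal $J\subseteq R$ let $\mathcal L(J)=\{\mathbf a\in\mathbb N^{n+1} : x_0^{a_0}\cdots x_n^{a_n}\in J\}$, and let the staircase of $J$ be the Minkowski sum $\operatorname{stairs}(J)=\mathcal L(J)+\mathbb R_{\ge 0}^{n+1}$. The symbolic polyhedron of $I$ is $$\mathcal Q=\bigcap_{P\in\operatorname{maxAss}(I)}\operatorname{conv}\bigl(\mathcal L(R\cap I R_P)\bigr)\subseteq\mathbb R^{n+1}$$ (an empty intersection is $\mathbb R^{n+1}$), and the $m$-th symbolic power of $I$ is $I^{(m)}=\bigcap_{P\in\operatorname{Ass}(I)}(R\cap I^mR_P)$ (an empty intersection is $R$). Then $$er\,\mathcal Q\subseteq\operatorname{stairs}(I^r)\qquad\text{for all integers } r\ge 0.$$ Moreover,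 if $I\neq 0$, then $I^{(er)}\subseteq I^r$ for all integers $r\ge 0$. -/

import Mathlib

open scoped Pointwise

namespace SymbPoly

section Ring

/-- The contraction `R ∩ J R_P` of an ideal `J` localized at a prime `P`. -/
noncomputable def localContraction {R : Type*} [CommRing R] (J : Ideal R)
    (P : PrimeSpectrum R) : Ideal R :=
  (J.map (algebraMap R (Localization.AtPrime P.asIdeal))).comap
    (algebraMap R (Localization.AtPrime P.asIdeal))

/-- The `m`-th symbolic power `I^(m) = R ∩ ⋂_{P ∈ Ass(I)} I^m R_P`, where `Ass(I)` is the set of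
associated primes of the module `R / I`. -/
noncomputable def symbolicPower {R : Type*} [CommRing R] (I : Ideal R) (m : ℕ) : Ideal R :=
  ⨅ (P : PrimeSpectrum R) (_ : P.asIdeal ∈ associatedPrimes R (R ⧸ I)),
    localContraction (I ^ m) P

/-- The big-height of `I`: the maximum of the heights of its associated primes
(and `0` for the unit ideal, which has no associated primes). -/
noncomputable def bigHeight {R : Type*} [CommRing R] (I : Ideal R) : ℕ∞ :=
  ⨆ P ∈ associatedPrimes R (R ⧸ I), P.height

/-- The associated primes of `I` that are maximal with respect to inclusion
among the associated primes of `I`. -/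
def maxAss {R : Type*} [CommRing R] (I : Ideal R) : Set (PrimeSpectrum R) :=
  {P | Maximal (fun p : Ideal R => p ∈ associatedPrimes R (R ⧸ I)) P.asIdeal}

end Ring

section Monomial

/-- A monomial ideal: an ideal generated by a set of monomials `x^a`. -/
def IsMonomialIdeal {σ k : Type*} [Field k] (I : Ideal (MvPolynomial σ k)) : Prop :=
  ∃ S : Set (σ →₀ ℕ), I = Ideal.span ((fun a => MvPolynomial.monomial a (1 : k)) '' S)

/-- The set of exponent vectors `a` of the monomials `x^a ∈ J`, viewed in real space. -/
def exponentSet {σ k : Type*} [Field k] (J : Ideal (MvPolynomial σ k)) : Set (σ → ℝ) :=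
  {v | ∃ a : σ →₀ ℕ, MvPolynomial.monomial a (1 : k) ∈ J ∧ v = fun i => (a i : ℝ)}

/-- The symbolic polyhedron `⋂_{P ∈ maxAss(I)} conv(L(R ∩ I R_P))`, with `L` the set of
exponent vectors. -/
def symbolicPolyhedron {σ k : Type*} [Field k] (I : Ideal (MvPolynomial σ k)) : Set (σ → ℝ) :=
  ⋂ P ∈ maxAss I, convexHull ℝ (exponentSet (localContraction I P))

/-- The staircase of `J`: the Minkowski sum of its exponent set and the nonnegative orthant. -/
def staircase {σ k : Type*} [Field k] (J : Ideal (MvPolynomial σ k)) : Set (σ → ℝ) :=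
  exponentSet J + {v : σ → ℝ | ∀ i, 0 ≤ v i}

end Monomial

end SymbPoly

/-! Each associated prime is generated by a set F of at most e variables, and variables outside F
are units after localizing. For w in the symbolic polyhedron, keep only the F-coordinates: conic
Carathéodory in dimension at most e gives an exponent of the local ideal lying below e•w on F
(`exists_le_mul_of_mem_convexHull`). Hence the floor of e•w is an exponent of every local ideal, so
of I, whence e•Q lies in the staircase of I; taking r-th powers gives the first claim. For the
second, an exponent of I^(er) divided by er lies in Q (`inv_smul_mem_convexHull_exponentSet`). -/

namespace SymbPoly

/-! ### Localization at associated primes -/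

section Ring

variable {R : Type*} [CommRing R]

theorem mem_localContraction {J : Ideal R} {P : PrimeSpectrum R} {f : R} :
    f ∈ localContraction J P ↔ ∃ s ∉ P.asIdeal, s * f ∈ J := by
  rw [localContraction, Ideal.mem_comap,
    IsLocalization.algebraMap_mem_map_algebraMap_iff P.asIdeal.primeCompl]
  simp only [Ideal.mem_primeCompl_iff]

theorem exists_colon_of_mem_associatedPrimes [IsNoetherianRing R] {I P : Ideal R}
    (hP : P ∈ associatedPrimes R (R ⧸ I)) :
    P.IsPrime ∧ ∃ f : R, ∀ p, p ∈ P ↔ p * f ∈ I := by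
  obtain ⟨hp, x, hx⟩ := isAssociatedPrime_iff.mp hP
  obtain ⟨f, rfl⟩ := Ideal.Quotient.mk_surjective x
  refine ⟨hp, f, fun p => ?_⟩
  rw [hx, Submodule.mem_colon_singleton, Submodule.mem_bot, Algebra.smul_def,
    Ideal.Quotient.algebraMap_eq, ← map_mul, Ideal.Quotient.eq_zero_iff_mem]

theorem le_of_mem_associatedPrimes [IsNoetherianRing R] {I P : Ideal R}
    (hP : P ∈ associatedPrimes R (R ⧸ I)) : I ≤ P := by
  obtain ⟨-, f, hf⟩ := exists_colon_of_mem_associatedPrimes hP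
  exact fun p hp => (hf p).2 (I.mul_mem_right f hp)

/-- If f is not in I, its annihilator modulo I lies in a maximal associated prime, so nothing
outside that prime kills f. -/
theorem mem_of_forall_mem_localContraction [IsNoetherianRing R] {I : Ideal R} {f : R}
    (h : ∀ P ∈ maxAss I, f ∈ localContraction I P) : f ∈ I := by
  by_contra hf
  obtain ⟨P, hP, hle⟩ := exists_le_isAssociatedPrime_of_isNoetherianRing R
    (Ideal.Quotient.mk I f) (by rwa [Ne, Ideal.Quotient.eq_zero_iff_mem])
  obtain ⟨M, hPM, hM⟩ := exists_maximal_ge_of_wellFoundedGT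
    (fun p : Ideal R => p ∈ associatedPrimes R (R ⧸ I)) P hP
  obtain ⟨s, hs, hsf⟩ := mem_localContraction.1 (h ⟨M, hM.prop.isPrime⟩ hM)
  refine hs (hPM (hle ?_))
  rw [Submodule.mem_colon_singleton, Submodule.mem_bot, Algebra.smul_def,
    Ideal.Quotient.algebraMap_eq, ← map_mul, Ideal.Quotient.eq_zero_iff_mem]
  exact hsf

end Ring

/-! ### Monomial ideals, their associated primes and heights -/

section Monomial

open MvPolynomial

variable {σ k : Type*} [Field k]

theorem support_monomial_one (c : σ →₀ ℕ) : (monomial c (1 : k)).support = {c} := by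
  classical
  rw [support_monomial, if_neg one_ne_zero]

theorem IsMonomialIdeal.mem_iff {I : Ideal (MvPolynomial σ k)} (hI : IsMonomialIdeal I)
    {f : MvPolynomial σ k} : f ∈ I ↔ ∀ c ∈ f.support, monomial c (1 : k) ∈ I := by
  obtain ⟨S, rfl⟩ := hI
  simp only [mem_ideal_span_monomial_image]
  refine forall₂_congr fun c _ => ?_
  simp [support_monomial_one, -mem_support_iff]

theorem monomial_mem_of_le {I : Ideal (MvPolynomial σ k)} {a b : σ →₀ ℕ} (hab : a ≤ b)
    (ha : monomial a (1 : k) ∈ I) : monomial b (1 : k) ∈ I := by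
  obtain ⟨c, rfl⟩ := exists_add_of_le hab
  have : monomial (a + c) (1 : k) = monomial c 1 * monomial a 1 := by
    rw [monomial_mul, one_mul, add_comm]
  exact this ▸ I.mul_mem_left _ ha

theorem span_monomial_image_pow (S : Set (σ →₀ ℕ)) (m : ℕ) :
    Ideal.span ((fun a => monomial a (1 : k)) '' S) ^ m =
      Ideal.span ((fun a => monomial a (1 : k)) '' (m • S)) := by
  induction m with
  | zero => simp [← Ideal.one_eq_top]
  | succ m ih =>
    rw [pow_succ, ih, Ideal.span_mul_span', succ_nsmul]
    congr 1
    ext f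
    simp only [Set.mem_mul, Set.mem_image, Set.mem_add]
    constructor
    · rintro ⟨_, ⟨a, ha, rfl⟩, _, ⟨b, hb, rfl⟩, rfl⟩
      exact ⟨a + b, ⟨a, ha, b, hb, rfl⟩, by simp [monomial_mul]⟩
    · rintro ⟨_, ⟨a, ha, b, hb, rfl⟩, rfl⟩
      exact ⟨_, ⟨a, ha, rfl⟩, _, ⟨b, hb, rfl⟩, by simp [monomial_mul]⟩

theorem IsMonomialIdeal.pow {I : Ideal (MvPolynomial σ k)} (hI : IsMonomialIdeal I) (m : ℕ) :
    IsMonomialIdeal (I ^ m) := by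
  obtain ⟨S, rfl⟩ := hI
  exact ⟨m • S, span_monomial_image_pow S m⟩

theorem IsMonomialIdeal.exists_sum_le {I : Ideal (MvPolynomial σ k)} (hI : IsMonomialIdeal I)
    {m : ℕ} {c : σ →₀ ℕ} (hc : monomial c (1 : k) ∈ I ^ m) :
    ∃ v : Fin m → σ →₀ ℕ, (∀ j, monomial (v j) (1 : k) ∈ I) ∧ ∑ j, v j ≤ c := by
  obtain ⟨S, rfl⟩ := hI
  rw [span_monomial_image_pow, mem_ideal_span_monomial_image] at hc
  obtain ⟨a, ha, hac⟩ := hc c (by simp [support_monomial_one, -mem_support_iff])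
  obtain ⟨v, rfl⟩ := Set.mem_nsmul.1 ha
  refine ⟨fun j => v j, fun j => Ideal.subset_span ⟨_, (v j).2, rfl⟩, ?_⟩
  rwa [List.sum_ofFn] at hac

/-- A product of two polynomials has a monomial which is a product of monomials of least weight
of the factors. -/
theorem exists_add_mem_support_mul (d : (σ →₀ ℕ) →+ ℕ) {p f : MvPolynomial σ k}
    (hp : p ≠ 0) (hf : f ≠ 0) :
    ∃ a ∈ p.support, ∃ b ∈ f.support, (∀ a' ∈ p.support, d a ≤ d a') ∧
      a + b ∈ (p * f).support := by
  classical
  obtain ⟨a₁, ha₁, hmina⟩ := p.support.exists_min_image d (by simpa using hp)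
  obtain ⟨b₁, hb₁, hminb⟩ := f.support.exists_min_image d (by simpa using hf)
  obtain ⟨a, ha, b, hb, hu⟩ := UniqueSums.uniqueAdd_of_nonempty
    (A := p.support.filter (d · = d a₁)) (B := f.support.filter (d · = d b₁))
    ⟨a₁, by simp [-mem_support_iff, ha₁]⟩ ⟨b₁, by simp [-mem_support_iff, hb₁]⟩
  rw [Finset.mem_filter] at ha hb
  refine ⟨a, ha.1, b, hb.1, fun a' h => ha.2 ▸ hmina a' h, ?_⟩
  have hco : coeff (a + b) (p * f) = coeff a p * coeff b f := by
    rw [coeff_mul]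
    refine Finset.sum_eq_single (a, b) (fun x hx hne => ?_) (by simp)
    by_contra h0
    have hx1 : x.1 ∈ p.support := mem_support_iff.2 (left_ne_zero_of_mul h0)
    have hx2 : x.2 ∈ f.support := mem_support_iff.2 (right_ne_zero_of_mul h0)
    have hsum : x.1 + x.2 = a + b := Finset.HasAntidiagonal.mem_antidiagonal.1 hx
    have h1 := hmina _ hx1
    have h2 := hminb _ hx2
    have h3 := congrArg d hsum
    rw [map_add, map_add, ha.2, hb.2] at h3
    obtain ⟨e1, e2⟩ := hu (a := x.1) (b := x.2) (Finset.mem_filter.2 ⟨hx1, by omega⟩)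
      (Finset.mem_filter.2 ⟨hx2, by omega⟩) hsum
    exact hne (Prod.ext e1 e2)
  rw [mem_support_iff, hco]
  exact mul_ne_zero (mem_support_iff.1 ha.1) (mem_support_iff.1 hb.1)

/-- Weigh monomials by their degree in F: p has a term free of F, so its least weight is zero. -/
theorem exists_add_mem_support_mul_of_notMem_span {F : Set σ} [Finite σ]
    {p f : MvPolynomial σ k} (hp : p ∉ Ideal.span (X '' F)) (hf : f ≠ 0) :
    ∃ a ∈ p.support, ∃ b ∈ f.support, (∀ i ∈ F, a i = 0) ∧ a + b ∈ (p * f).support := by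
  classical
  have := Fintype.ofFinite σ
  let d : (σ →₀ ℕ) →+ ℕ := ∑ i ∈ F.toFinset, Finsupp.applyAddHom i
  have hd : ∀ a, d a = 0 ↔ ∀ i ∈ F, a i = 0 := fun a => by
    simp [d]
  have hp0 : p ≠ 0 := by
    rintro rfl
    exact hp (Ideal.zero_mem _)
  obtain ⟨a, ha, b, hb, hmin, hab⟩ := exists_add_mem_support_mul d hp0 hf
  refine ⟨a, ha, b, hb, (hd a).1 ?_, hab⟩
  rw [mem_ideal_span_X_image] at hp
  push Not at hp
  obtain ⟨a', ha', h'⟩ := hp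
  exact Nat.le_zero.1 (((hd a').2 h') ▸ hmin a' ha')

theorem monomial_notMem {F : Set σ} {a : σ →₀ ℕ} (ha : ∀ i ∈ F, a i = 0) :
    monomial a (1 : k) ∉ Ideal.span (X '' F) := by
  rw [mem_ideal_span_X_image]
  simpa [support_monomial_one, -mem_support_iff] using ha

theorem IsMonomialIdeal.eq_span_of_mem_associatedPrimes [Finite σ]
    {I : Ideal (MvPolynomial σ k)} (hI : IsMonomialIdeal I) {P : Ideal (MvPolynomial σ k)}
    (hP : P ∈ associatedPrimes _ (MvPolynomial σ k ⧸ I)) :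
    P = Ideal.span (X '' {i | X i ∈ P}) := by
  classical
  have hle : Ideal.span (X '' {i | X i ∈ P}) ≤ P := by
    rw [Ideal.span_le]
    rintro _ ⟨i, hi, rfl⟩
    exact hi
  refine le_antisymm (fun p hp => ?_) hle
  obtain ⟨hprime, hex⟩ := exists_colon_of_mem_associatedPrimes hP
  let A : Set (MvPolynomial σ k) := {f | ∀ p, p ∈ P ↔ p * f ∈ I}
  -- Among all f with P = (I : f), take one of smallest support. A monomial outside P that sends a
  -- term of f into I then yields a shorter such f.
  obtain ⟨f, hfA, hmin⟩ := WellFounded.has_min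
    (measure fun f : MvPolynomial σ k => f.support.card).wf A hex
  by_contra hpF
  have hf0 : f ≠ 0 := by
    rintro rfl
    exact hprime.ne_top ((Ideal.eq_top_iff_one P).2 ((hfA 1).2 (by simp)))
  obtain ⟨a, ha, b, hb, haF, hab⟩ := exists_add_mem_support_mul_of_notMem_span hpF hf0
  have habI := hI.mem_iff.1 ((hfA p).1 hp) _ hab
  have haP : monomial a (1 : k) ∉ P := by
    have hpow : ∏ i ∈ a.support, (X i : MvPolynomial σ k) ^ a i = monomial a 1 := by
      rw [monomial_eq, C_1, one_mul, Finsupp.prod]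
    rw [← hpow, hprime.prod_mem_iff]
    rintro ⟨i, hi, hiP⟩
    exact Finsupp.mem_support_iff.1 hi (haF i (hprime.mem_of_pow_mem _ hiP))
  let f' := f - monomial b (coeff b f)
  have hf' : f'.support ⊆ f.support.erase b := by
    intro c hc
    rw [mem_support_iff, coeff_sub, coeff_monomial] at hc
    by_cases hbc : b = c
    · subst hbc; simp at hc
    · rw [if_neg hbc, sub_zero] at hc
      exact Finset.mem_erase.2 ⟨Ne.symm hbc, mem_support_iff.2 hc⟩
  refine hmin (monomial a 1 * f') (fun q => ?_) ?_
  · have h1 : q * (monomial a 1 * f') =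
        (q * monomial a 1) * f - q * (C (coeff b f) * monomial (a + b) 1) := by
      rw [C_mul_monomial, mul_one]
      simp only [f', mul_sub, monomial_mul, one_mul, mul_assoc]
    rw [h1, Submodule.sub_mem_iff_left _ (I.mul_mem_left _ (I.mul_mem_left _ habI)), ← hfA]
    exact ⟨fun h => P.mul_mem_right _ h, fun h => (hprime.mem_or_mem h).resolve_right haP⟩
  · change (monomial a 1 * f').support.card < f.support.card
    have h1 : (monomial a (1 : k) * f').support.card ≤ f'.support.card := by
      refine (Finset.card_le_card (support_mul _ _)).trans ?_
      refine Finset.card_add_le.trans ?_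
      simp [support_monomial]
    exact (h1.trans (Finset.card_le_card hf')).trans_lt (Finset.card_erase_lt_of_mem hb)

theorem IsMonomialIdeal.exists_add_mem_of_mem_localContraction [Finite σ]
    {J : Ideal (MvPolynomial σ k)} (hJ : IsMonomialIdeal J)
    {P : PrimeSpectrum (MvPolynomial σ k)} {F : Set σ} (hP : P.asIdeal = Ideal.span (X '' F))
    {f : MvPolynomial σ k} (hf : f ∈ localContraction J P) {c : σ →₀ ℕ} (hc : c ∈ f.support) :
    ∃ d : σ →₀ ℕ, (∀ i ∈ F, d i = 0) ∧ monomial (c + d) (1 : k) ∈ J := by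
  classical
  -- Discard the terms already in the contraction; the remainder must vanish, since `hkey` would put
  -- one of its terms there.
  obtain ⟨f', hf', hfT, hdisj⟩ : ∃ f' ∈ localContraction J P,
      (∀ b ∈ f.support, monomial b (1 : k) ∉ localContraction J P → b ∈ f'.support) ∧
      ∀ b ∈ f'.support, monomial b (1 : k) ∉ localContraction J P := by
    let g := ∑ b ∈ f.support with monomial b (1 : k) ∈ localContraction J P,
      monomial b (coeff b f)
    have hg : g ∈ localContraction J P := Ideal.sum_mem _ fun b hb => by
      have := (localContraction J P).mul_mem_left (C (coeff b f)) (Finset.mem_filter.1 hb).2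
      rwa [C_mul_monomial, mul_one] at this
    have hcg : ∀ b, coeff b g =
        if monomial b (1 : k) ∈ localContraction J P then coeff b f else 0 := fun b => by
      simp only [g, coeff_sum, coeff_monomial, Finset.sum_ite_eq', Finset.mem_filter,
        mem_support_iff]
      split_ifs with h1 h2 h2 <;> tauto
    refine ⟨f - g, Ideal.sub_mem _ hf hg, fun b hb hbn => ?_, fun b hb hbn => ?_⟩
    · rw [mem_support_iff, coeff_sub, hcg, if_neg hbn, sub_zero]
      exact mem_support_iff.1 hb
    · rw [mem_support_iff, coeff_sub, hcg, if_pos hbn, sub_self] at hb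
      exact hb rfl
  have hkey : ∀ h ∈ localContraction J P, h ≠ 0 → ∃ b ∈ h.support, ∃ d : σ →₀ ℕ,
      (∀ i ∈ F, d i = 0) ∧ monomial (b + d) (1 : k) ∈ J := by
    intro h hh h0
    obtain ⟨s, hs, hsh⟩ := mem_localContraction.1 hh
    obtain ⟨a, -, b, hb, haF, hab⟩ :=
      exists_add_mem_support_mul_of_notMem_span (hP ▸ hs) h0
    exact ⟨b, hb, a, haF, add_comm a b ▸ hJ.mem_iff.1 hsh _ hab⟩
  have hf'0 : f' = 0 := by
    by_contra h0
    obtain ⟨b, hb, d, hdF, hbd⟩ := hkey f' hf' h0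
    refine hdisj b hb (mem_localContraction.2 ⟨monomial d 1, hP ▸ monomial_notMem hdF, ?_⟩)
    rwa [monomial_mul, one_mul, add_comm]
  have hcm : monomial c (1 : k) ∈ localContraction J P := by
    by_contra hcn
    simpa [hf'0] using hfT c hc hcn
  obtain ⟨b, hb, d, hd⟩ := hkey _ hcm (by simp)
  rw [support_monomial_one, Finset.mem_singleton] at hb
  exact ⟨d, hb ▸ hd⟩

/-- The substitution of `0` for the variables in `F`. -/
noncomputable def killVars (k : Type*) [Field k] (F : Finset σ) :
    MvPolynomial σ k →ₐ[k] MvPolynomial σ k :=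
  open Classical in aeval fun i => if i ∈ F then 0 else X i

theorem killVars_comp [DecidableEq σ] (F : Finset σ) (i : σ) :
    (killVars k (insert i F)).comp (killVars k F) = killVars k (insert i F) := by
  ext1 j
  by_cases hj : j ∈ F <;> simp [killVars, hj]

theorem ker_killVars_le {F : Finset σ} {P : Ideal (MvPolynomial σ k)}
    (hF : ∀ i ∈ F, X i ∈ P) : RingHom.ker (killVars k F) ≤ P := by
  intro f hf
  have h : (Ideal.Quotient.mkₐ k P).comp (killVars k F) = Ideal.Quotient.mkₐ k P := by
    ext1 j
    by_cases hj : j ∈ F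
    · simp [killVars, hj, (Ideal.Quotient.eq_zero_iff_mem.2 (hF j hj))]
    · simp [killVars, hj]
  have h2 := DFunLike.congr_fun h f
  rw [AlgHom.comp_apply, (RingHom.mem_ker).1 hf, map_zero] at h2
  exact Ideal.Quotient.eq_zero_iff_mem.1 h2.symm

/-- Killing the variables one at a time gives a strict chain of prime kernels. -/
theorem card_le_height_ker_killVars (F : Finset σ) :
    (F.card : ℕ∞) ≤ (RingHom.ker (killVars k F)).height := by
  classical
  induction F using Finset.induction_on with
  | empty => simp
  | insert i F hi ih =>
    have hprime : ∀ G : Finset σ, (RingHom.ker (killVars k G)).IsPrime :=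
      fun G => RingHom.ker_isPrime _
    have hlt : RingHom.ker (killVars k F) < RingHom.ker (killVars k (insert i F)) := by
      refine lt_of_le_of_ne (fun f hf => ?_) fun h => ?_
      · rw [RingHom.mem_ker] at hf ⊢
        rw [← killVars_comp, AlgHom.comp_apply, hf, map_zero]
      · have : (X i : MvPolynomial σ k) ∈ RingHom.ker (killVars k F) := by
          rw [h, RingHom.mem_ker]
          simp [killVars]
        rw [RingHom.mem_ker] at this
        simp [killVars, hi] at this
    have := hprime F
    have := hprime (insert i F)
    rw [Finset.card_insert_of_notMem hi, Nat.cast_add, Nat.cast_one]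
    exact (add_le_add_left ih 1).trans (Ideal.height_add_one_le_of_lt_of_isPrime hlt)

theorem card_le_height {F : Finset σ} {P : Ideal (MvPolynomial σ k)}
    (hF : ∀ i ∈ F, X i ∈ P) : (F.card : ℕ∞) ≤ P.height :=
  (card_le_height_ker_killVars F).trans (Ideal.height_mono (ker_killVars_le hF))

end Monomial

/-! ### Carathéodory and the symbolic polyhedron -/

section Polyhedron

/-- Conic Carathéodory: if a subconvex point of a finite set of nonnegative vectors in dimension at
most `e` lies below `w`, then some vector of the set lies below `e • w`. -/
theorem exists_le_smul_of_sum_smul_le {ι : Type*} [Fintype ι] {e : ℕ}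
    (he : Fintype.card ι ≤ e) {w : ι → ℝ} (s : Finset (ι → ℝ)) (hs : ∀ v ∈ s, 0 ≤ v)
    (c : (ι → ℝ) → ℝ) (hc : ∀ v ∈ s, 0 ≤ c v) (hc1 : 1 ≤ ∑ v ∈ s, c v)
    (hw : ∑ v ∈ s, c v • v ≤ w) : ∃ v ∈ s, v ≤ (e : ℝ) • w := by
  classical
  induction hN : s.card using Nat.strong_induction_on generalizing s c with
  | _ N ih =>
  have hterm : ∀ v ∈ s, 0 ≤ c v • v := fun v hv => smul_nonneg (hc v hv) (hs v hv)
  by_cases hcard : s.card ≤ Fintype.card ι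
  · obtain ⟨v, hv, hv1⟩ : ∃ v ∈ s, 1 ≤ (e : ℝ) * c v := by
      by_contra! hlt
      have hne : s.Nonempty := by
        by_contra hne
        rw [Finset.not_nonempty_iff_eq_empty] at hne
        simp [hne] at hc1
        linarith
      have h1 := Finset.sum_lt_sum_of_nonempty hne hlt
      rw [← Finset.mul_sum, Finset.sum_const, nsmul_eq_mul, mul_one] at h1
      have h2 : (s.card : ℝ) ≤ e := by exact_mod_cast hcard.trans he
      have h3 : (e : ℝ) * 1 ≤ e * ∑ v ∈ s, c v := by gcongr
      linarith
    refine ⟨v, hv, fun i => ?_⟩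
    have h1 : c v * v i ≤ w i := by
      have := (Finset.single_le_sum hterm hv).trans hw i
      simpa using this
    have h2 : 0 ≤ v i := hs v hv i
    calc v i = 1 * v i := (one_mul _).symm
      _ ≤ (e * c v) * v i := by gcongr
      _ = e * (c v * v i) := mul_assoc _ _ _
      _ ≤ e * w i := by gcongr
  · push Not at hcard
    -- A linear, not affine, relation suffices, as the total weight may grow; this gives e rather
    -- than e + 1.
    obtain ⟨g, hg0, x, hx, hgx, hgs⟩ : ∃ g : (ι → ℝ) → ℝ, ∑ v ∈ s, g v • v = 0 ∧
        ∃ x ∈ s, g x ≠ 0 ∧ 0 ≤ ∑ v ∈ s, g v := by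
      obtain ⟨g, hg0, x, hx, hgx⟩ := Module.exists_nontrivial_relation_of_finrank_lt_card
        (R := ℝ) (M := ι → ℝ) (t := s) (by simpa using hcard)
      rcases le_total 0 (∑ v ∈ s, g v) with h | h
      · exact ⟨g, hg0, x, hx, hgx, h⟩
      · refine ⟨-g, ?_, x, hx, by simpa using hgx, by simpa using h⟩
        simpa using hg0
    by_cases hneg : ∃ v ∈ s, g v < 0
    -- Ratio test: move along g until the first coefficient vanishes.
    · obtain ⟨v₀, hv₀, hmin⟩ := (s.filter (g · < 0)).exists_min_image (fun v => c v / -g v)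
        (by obtain ⟨v, hv, h⟩ := hneg; exact ⟨v, Finset.mem_filter.2 ⟨hv, h⟩⟩)
      obtain ⟨hv₀, hg₀⟩ := Finset.mem_filter.1 hv₀
      set t := c v₀ / -g v₀ with ht
      have ht0 : 0 ≤ t := div_nonneg (hc _ hv₀) (by linarith)
      have hzero : c v₀ + t * g v₀ = 0 := by
        rw [ht, div_neg, neg_mul, div_mul_cancel₀ _ hg₀.ne, add_neg_cancel]
      obtain ⟨v, hv, hle⟩ := ih (s.erase v₀).card
        (hN ▸ Finset.card_erase_lt_of_mem hv₀) (s.erase v₀)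
        (fun v hv => hs v (Finset.mem_of_mem_erase hv)) (fun v => c v + t * g v)
        (fun v hv => by
          have hv := Finset.mem_of_mem_erase hv
          rcases lt_or_ge (g v) 0 with h | h
          · have := hmin v (Finset.mem_filter.2 ⟨hv, h⟩)
            rw [le_div_iff₀ (by linarith)] at this
            linarith
          · exact add_nonneg (hc v hv) (mul_nonneg ht0 h))
        (by
          rw [Finset.sum_erase s hzero, Finset.sum_add_distrib, ← Finset.mul_sum]
          have := mul_nonneg ht0 hgs
          linarith)
        (by
          rw [Finset.sum_erase s (by simp [hzero])]
          simp only [add_smul, mul_smul, Finset.sum_add_distrib]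
          rw [← Finset.smul_sum, hg0, smul_zero, add_zero]
          exact hw) rfl
      exact ⟨v, Finset.mem_of_mem_erase hv, hle⟩
    · push Not at hneg
      have h0 := (Finset.sum_eq_zero_iff_of_nonneg
        fun v hv => smul_nonneg (hneg v hv) (hs v hv)).1 hg0 x hx
      have hx0 : x = 0 := (smul_eq_zero.1 h0).resolve_left hgx
      refine ⟨x, hx, hx0 ▸ smul_nonneg (Nat.cast_nonneg e) ?_⟩
      exact (Finset.sum_nonneg hterm).trans hw

open MvPolynomial

variable {σ k : Type*} [Field k]

theorem monomial_mem_localContraction_of_add {I : Ideal (MvPolynomial σ k)}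
    {P : PrimeSpectrum (MvPolynomial σ k)} {F : Finset σ} (hP : P.asIdeal = Ideal.span (X '' F))
    {a d : σ →₀ ℕ} (hd : ∀ i ∈ F, d i = 0)
    (ha : monomial (a + d) (1 : k) ∈ localContraction I P) :
    monomial a (1 : k) ∈ localContraction I P := by
  obtain ⟨s, hs, hsa⟩ := mem_localContraction.1 ha
  refine mem_localContraction.2 ⟨s * monomial d 1, fun h => ?_, ?_⟩
  · rcases P.isPrime.mem_or_mem h with h | h
    · exact hs h
    · exact monomial_notMem (by simpa using hd) (hP ▸ h)
  · rwa [mul_assoc, monomial_mul, one_mul, add_comm d a]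

theorem exists_finset_of_mem_associatedPrimes [Finite σ] {I : Ideal (MvPolynomial σ k)}
    (hI : IsMonomialIdeal I) {e : ℕ} (he : bigHeight I = e) {P : Ideal (MvPolynomial σ k)}
    (hP : P ∈ associatedPrimes _ (MvPolynomial σ k ⧸ I)) :
    ∃ F : Finset σ, P = Ideal.span (X '' F) ∧ F.card ≤ e := by
  classical
  have := Fintype.ofFinite σ
  let F : Finset σ := {i | X i ∈ P}
  refine ⟨F, by simpa [F] using hI.eq_span_of_mem_associatedPrimes hP, ?_⟩
  have h1 : (F.card : ℕ∞) ≤ P.height := card_le_height (by simp [F])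
  have h2 : P.height ≤ bigHeight I :=
    le_iSup₂ (f := fun (P : Ideal (MvPolynomial σ k))
      (_ : P ∈ associatedPrimes _ (MvPolynomial σ k ⧸ I)) => P.height) P hP
  exact_mod_cast (h1.trans h2).trans he.le

theorem nonneg_of_mem_convexHull_exponentSet {J : Ideal (MvPolynomial σ k)} {w : σ → ℝ}
    (hw : w ∈ convexHull ℝ (exponentSet J)) : 0 ≤ w := by
  refine convexHull_min (t := Set.Ici 0) ?_ (convex_Ici 0) hw
  rintro _ ⟨a, -, rfl⟩ i
  exact Nat.cast_nonneg _

theorem exists_le_mul_of_mem_convexHull [Finite σ] {J : Ideal (MvPolynomial σ k)} {F : Finset σ}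
    {e : ℕ} (hF : F.card ≤ e) {w : σ → ℝ} (hw : w ∈ convexHull ℝ (exponentSet J)) :
    ∃ a : σ →₀ ℕ, monomial a (1 : k) ∈ J ∧ ∀ i ∈ F, (a i : ℝ) ≤ e * w i := by
  let ρ : (σ → ℝ) →ₗ[ℝ] (F → ℝ) := LinearMap.funLeft ℝ ℝ Subtype.val
  have h1 : ρ w ∈ convexHull ℝ (ρ '' exponentSet J) := by
    rw [← ρ.image_convexHull]
    exact ⟨w, hw, rfl⟩
  rw [convexHull_eq_union_convexHull_finite_subsets] at h1
  simp only [Set.mem_iUnion] at h1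
  obtain ⟨t, ht, hwt⟩ := h1
  obtain ⟨c, hc0, hc1, hcw⟩ := Finset.mem_convexHull'.1 hwt
  obtain ⟨v, hv, hle⟩ := exists_le_smul_of_sum_smul_le (by simpa using hF) t
    (fun v hv => by
      obtain ⟨_, ⟨a, -, rfl⟩, rfl⟩ := ht hv
      exact fun i => Nat.cast_nonneg _) c hc0 hc1.ge hcw.le
  obtain ⟨_, ⟨a, ha, rfl⟩, rfl⟩ := ht hv
  exact ⟨a, ha, fun i hi => hle ⟨i, hi⟩⟩

/-- A point of the symbolic polyhedron scaled by the big-height dominates an exponent of `I`. -/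
theorem exists_le_mul_of_mem_symbolicPolyhedron [Finite σ] {I : Ideal (MvPolynomial σ k)}
    (hI : IsMonomialIdeal I) {e : ℕ} (he : bigHeight I = e) {w : σ → ℝ}
    (hw : w ∈ symbolicPolyhedron I) :
    ∃ a : σ →₀ ℕ, monomial a (1 : k) ∈ I ∧ ∀ i, (a i : ℝ) ≤ e * w i := by
  classical
  have hw' : ∀ P ∈ maxAss I, w ∈ convexHull ℝ (exponentSet (localContraction I P)) :=
    fun P hP => Set.mem_iInter₂.1 hw P hP
  -- Here Q is the whole space, so w may be negative; e = 0 saves the claim.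
  by_cases htop : I = ⊤
  · subst htop
    have : Subsingleton (MvPolynomial σ k ⧸ (⊤ : Ideal (MvPolynomial σ k))) :=
      Ideal.Quotient.subsingleton_iff.2 rfl
    have he0 : e = 0 := by
      simpa [bigHeight, associatedPrimes.eq_empty_of_subsingleton, eq_comm] using he
    exact ⟨0, trivial, by simp [he0]⟩
  have hw0 : 0 ≤ w := by
    by_contra h0
    refine htop ((Ideal.eq_top_iff_one I).2 (mem_of_forall_mem_localContraction fun P hP => ?_))
    exact (h0 (nonneg_of_mem_convexHull_exponentSet (hw' P hP))).elim
  let b : σ →₀ ℕ := Finsupp.equivFunOnFinite.symm fun i => ⌊(e : ℝ) * w i⌋₊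
  refine ⟨b, mem_of_forall_mem_localContraction fun P hP => ?_, fun i =>
    Nat.floor_le (mul_nonneg (Nat.cast_nonneg e) (hw0 i))⟩
  obtain ⟨F, hPF, hFe⟩ := exists_finset_of_mem_associatedPrimes hI he hP.prop
  obtain ⟨a, ha, hle⟩ := exists_le_mul_of_mem_convexHull hFe (hw' P hP)
  refine monomial_mem_of_le (a := a.filter (· ∈ F)) (fun i => ?_)
    (monomial_mem_localContraction_of_add hPF (d := a.filter (· ∉ F))
      (fun i hi => Finsupp.filter_apply_neg _ _ (by simpa using hi))
      (by rwa [Finsupp.filter_add_filter_not]))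
  by_cases hi : i ∈ F
  · rw [Finsupp.filter_apply_pos _ _ hi]
    exact Nat.le_floor (hle i hi)
  · rw [Finsupp.filter_apply_neg _ _ hi]
    exact Nat.zero_le _

theorem monomial_nsmul_mem_pow {I : Ideal (MvPolynomial σ k)} {a : σ →₀ ℕ}
    (ha : monomial a (1 : k) ∈ I) (r : ℕ) : monomial (r • a) (1 : k) ∈ I ^ r := by
  have := Ideal.pow_mem_pow ha r
  rwa [monomial_pow, one_pow] at this

/-- Exponents of the `m`-th power of a localization are `m`-multiples of points of the convex hull
of the exponents of the localization. -/
theorem inv_smul_mem_convexHull_exponentSet [Finite σ] {I : Ideal (MvPolynomial σ k)}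
    (hI : IsMonomialIdeal I) {P : PrimeSpectrum (MvPolynomial σ k)} {F : Finset σ}
    (hP : P.asIdeal = Ideal.span (X '' F)) {m : ℕ} (hm : 0 < m) {f : MvPolynomial σ k}
    (hf : f ∈ localContraction (I ^ m) P) {c : σ →₀ ℕ} (hc : c ∈ f.support) :
    (fun i => (m : ℝ)⁻¹ * c i) ∈ convexHull ℝ (exponentSet (localContraction I P)) := by
  classical
  obtain ⟨d, hd, hcd⟩ := (hI.pow m).exists_add_mem_of_mem_localContraction hP hf hc
  obtain ⟨v, hv, hvle⟩ := hI.exists_sum_le hcd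
  let v₁ : Fin m → σ →₀ ℕ := fun j => (v j).filter (· ∈ F)
  have hv₁ : ∀ j, monomial (v₁ j) (1 : k) ∈ localContraction I P := fun j =>
    monomial_mem_localContraction_of_add hP (d := (v j).filter (· ∉ F))
      (fun i hi => Finsupp.filter_apply_neg _ _ (by simpa using hi))
      (by
        rw [Finsupp.filter_add_filter_not]
        exact Ideal.le_comap_map (hv j))
  have hle : ∑ j, v₁ j ≤ c := fun i => by
    rw [Finsupp.finsetSum_apply]
    by_cases hi : i ∈ F
    · have := hvle i
      rw [Finsupp.finsetSum_apply, Finsupp.add_apply, hd i hi, add_zero] at this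
      simpa [v₁, hi] using this
    · simp [v₁, hi]
  obtain ⟨u, hu⟩ := exists_add_of_le hle
  -- The surplus u goes to one summand, making the sum exactly c.
  let v₂ : Fin m → σ →₀ ℕ := fun j => v₁ j + if j = ⟨0, hm⟩ then u else 0
  have hsum : ∑ j, v₂ j = c := by simp [v₂, Finset.sum_add_distrib, hu]
  have key := (convex_convexHull ℝ (exponentSet (localContraction I P))).sum_mem
    (t := Finset.univ) (w := fun _ : Fin m => (m : ℝ)⁻¹) (z := fun j i => (v₂ j i : ℝ))
    (fun _ _ => by positivity) (by simp [hm.ne'])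
    (fun j _ => subset_convexHull ℝ _ ⟨v₂ j, monomial_mem_of_le le_self_add (hv₁ j), rfl⟩)
  convert key using 1
  ext i
  rw [← hsum, Finset.sum_apply, Finsupp.finsetSum_apply]
  simp [Finset.mul_sum]

theorem smul_symbolicPolyhedron_subset_staircase [Finite σ] {I : Ideal (MvPolynomial σ k)}
    (hI : IsMonomialIdeal I) {e : ℕ} (he : bigHeight I = e) (r : ℕ) :
    ((e * r : ℕ) : ℝ) • symbolicPolyhedron I ⊆ staircase (I ^ r) := by
  rintro _ ⟨w, hw, rfl⟩
  obtain ⟨a, ha, hle⟩ := exists_le_mul_of_mem_symbolicPolyhedron hI he hw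
  refine ⟨_, ⟨r • a, monomial_nsmul_mem_pow ha r, rfl⟩,
    fun i => r * (e * w i - a i), fun i => mul_nonneg (Nat.cast_nonneg r) (sub_nonneg.2 (hle i)),
    ?_⟩
  ext i
  simp
  ring

theorem symbolicPower_le_pow [Finite σ] {I : Ideal (MvPolynomial σ k)}
    (hI : IsMonomialIdeal I) {e : ℕ} (he : bigHeight I = e) (hI0 : I ≠ ⊥) (r : ℕ) :
    symbolicPower I (e * r) ≤ I ^ r := by
  rcases Nat.eq_zero_or_pos r with rfl | hr
  · simp
  -- No division by er when e = 0: any associated prime would then be zero and contain I ≠ 0, so I =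
  -- R.
  rcases Nat.eq_zero_or_pos e with rfl | he0
  · have htop : I = ⊤ := by
      refine (Ideal.eq_top_iff_one I).2 (mem_of_forall_mem_localContraction fun P hP => ?_)
      obtain ⟨F, hPF, hF⟩ := exists_finset_of_mem_associatedPrimes hI he hP.prop
      rw [Nat.le_zero, Finset.card_eq_zero] at hF
      refine (hI0 (le_bot_iff.1 ?_)).elim
      simpa [hPF, hF] using le_of_mem_associatedPrimes hP.prop
    simp [htop, Ideal.top_pow]
  intro f hf
  refine (hI.pow r).mem_iff.2 fun c hc => ?_
  simp only [symbolicPower, Ideal.mem_iInf] at hf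
  have hcQ : (fun i => ((e * r : ℕ) : ℝ)⁻¹ * c i) ∈ symbolicPolyhedron I :=
    Set.mem_iInter₂.2 fun P hP => by
      obtain ⟨F, hPF, -⟩ := exists_finset_of_mem_associatedPrimes hI he hP.prop
      exact inv_smul_mem_convexHull_exponentSet hI hPF (Nat.mul_pos he0 hr) (hf P hP.prop) hc
  obtain ⟨a, ha, hle⟩ := exists_le_mul_of_mem_symbolicPolyhedron hI he hcQ
  refine monomial_mem_of_le (fun i => ?_) (monomial_nsmul_mem_pow ha r)
  have h1 := hle i
  have h2 : (e : ℝ) * (((e * r : ℕ) : ℝ)⁻¹ * c i) = c i / r := by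
    push_cast; field_simp
  rw [h2, le_div_iff₀ (by exact_mod_cast hr)] at h1
  rw [Finsupp.smul_apply, smul_eq_mul, mul_comm]
  exact_mod_cast h1

end Polyhedron

end SymbPoly

theorem mainTheorem7 {k : Type*} [Field k] (n : ℕ)
    (I : Ideal (MvPolynomial (Fin (n + 1)) k)) (hI : SymbPoly.IsMonomialIdeal I)
    (e : ℕ) (he : SymbPoly.bigHeight I = (e : ℕ∞)) :
    (∀ r : ℕ, ((e * r : ℕ) : ℝ) • SymbPoly.symbolicPolyhedron I ⊆ SymbPoly.staircase (I ^ r)) ∧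
    (I ≠ ⊥ → ∀ r : ℕ, SymbPoly.symbolicPower I (e * r) ≤ I ^ r) :=
  ⟨SymbPoly.smul_symbolicPolyhedron_subset_staircase hI he,
    SymbPoly.symbolicPower_le_pow hI he⟩
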